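/- Notation. $\mathbb{N}=\{1,2,\dots\}$, $\sigma(x)=\max\{x,0\}$ (applied entrywise to vectors), and $\|\cdot\|_\infty$ is the sup-norm on sequences. An operator $F:([-1,1]^d)^{\mathbb{Z}}\to\mathbb{R}^{\mathbb{Z}}$ is *causal* if $F(u)_t=F(v)_t$ whenever $u_k=v_k$ for all $k\le t$; *time-invariant* if $F\big((u_{s-\tau})_s\big)_t=F(u)_{t-\tau}$ for all $\tau,t\in\mathbb{Z}$; *continuous* if it is uniformly bounded and continuous for the product topologies. For a causal $F$ and a left infinite sequence $u_-\in([-1,1]^d)^{\mathbb{Z}_-}$, $\mathbb{Z}_-=\{\dots,-1,0\}$, put $F^*(u_-):=F(u)_0$, where $u$ is any extension of $u_-$ to $\mathbb{Z}$, and for $m\in\mathbb{N}$ $$F^*_m(u_{-m+1},\dots,u_0):=F^*(\dots,0,0,u_{-m+1},\dots,u_0),\qquad \mathcal{E}_F(m):=\sup_{u\in([-1,1]^d)^{\mathbb{Z}_-}}\big|F^*(u)-F^*_m(u_{-m+1},\dots,u_0)\big| .$$ Theorem. Let $n,m,d\in\mathbb{N}$ and $\delta\in(0,1)$. Let $(w_1^\intercal,b_1),\dots,(w_n^\intercal,b_n)$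 be i.i.d. samples from the uniform distribution on $[-1/2,1/2]^{md+1}$, and put $W=(w_1,\dots,w_n)^\intercal\in\mathbb{R}^{n\times md}$, $b=(b_1,\dots,b_n)^\intercal\in\mathbb{R}^n$. Let $P\in\mathbb{R}^{md\times md}$ be the $m\times m$ block matrix with $d\times d$ blocks that has $I_d$ on the first block superdiagonal and zero blocks elsewhere, and let $Q\in\mathbb{R}^{md\times d}$ consist of $m$ blocks of size $d\times d$, of which the last is $I_d$ and the others are zero. Consider the ReLU echo state network $$ s_t=\sigma\big(W(\tfrac{24}{n}PW^\intercal s_{t-1}+Qu_t)+b\big),\qquad y_t=a\cdot s_t, \qquad s_t,a\in\mathbb{R}^n. $$ It has the *existence of solutions property* if for every $u\in([-1,1]^d)^{\mathbb{Z}_-}$ there is $s\in(\mathbb{R}^n)^{\mathbb{Z}_-}$ that satisfies the state equation for every $t\in\mathbb{Z}_-$. Any choice of such a solution $s(u)$ for each $u\in([-1,1]^d)^{\mathbb{Z}_-}$ determines, together with $a$, a *corresponding operator* $F_{\mathrm{ESN}}$, namely the causal time-invariant operator with $F_{\mathrm{ESN}}^*(u)=a\cdot s(u)_0$. Let $$c(m,\delta,d)=1152\,m^2(md+1)^2\big(4\sqrt{md+1}+\sqrt{\log(4md/\delta)}\big)^2$$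 and suppose that $n/\log(n+1)\ge c(m,\delta,d)$. Let $F:([-1,1]^d)^{\mathbb{Z}}\to\mathbb{R}^{\mathbb{Z}}$ be a continuous causal time-invariant operator such that, for some measurable function $g_m$ with $|g_m|\le B_m$ on $[-1/2,1/2]^{md}\times[-1/2,1/2]$, $$F^*_m(x)=\int_{-1/2}^{1/2}\int_{[-1/2,1/2]^{md}} g_m(w,b)\,\sigma(w\cdot x+b)\,dw\,db\qquad\text{for all }x\in[-1,1]^{md}.$$ Then, with probability at least $1-\delta$ (that is, on a measurable event of probability at least $1-\delta$), the network has the existence of solutions property and there exist $a\in\mathbb{R}^n$ and a corresponding operator $F_{\mathrm{ESN}}$ such that $$\sup_{u\in([-1,1]^d)^{\mathbb{Z}}}\|F(u)-F_{\mathrm{ESN}}(u)\|_\infty\le C(m,\delta,d)\sqrt{\frac{\log(n+1)}{n}}+\mathcal{E}_F(m),$$ where $$C(m,\delta,d)=\sqrt2\,B_m(md+1)(3m^2d+1)\big(4\sqrt{md+1}+\sqrt{\log(4md/\delta)}\big).$$ -/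

import Mathlib

open MeasureTheory ProbabilityTheory

noncomputable section

namespace ESN

/-- The interval `[-1, 1]`, as a subtype of the reals. -/
abbrev Box : Type := Set.Icc (-1 : ℝ) 1

/-- The number `0`, as a point of `[-1, 1]`. -/
def zeroBox : Box := ⟨0, by norm_num, by norm_num⟩

/-- Bi-infinite input sequences, `([-1,1]^d)^ℤ`. -/
abbrev Input (d : ℕ) : Type := ℤ → Fin d → Box

/-- Left infinite input sequences `(…, u₋₁, u₀)`, i.e. `([-1,1]^d)^{ℤ₋}`.
The entry at time `-k` is stored at the index `k : ℕ`. -/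
abbrev PastInput (d : ℕ) : Type := ℕ → Fin d → Box

/-- Causality: the output at time `t` depends on the input up to time `t` only. -/
def IsCausal {d : ℕ} (F : Input d → ℤ → ℝ) : Prop :=
  ∀ (u v : Input d) (t : ℤ), (∀ k ≤ t, u k = v k) → F u t = F v t

/-- Time-invariance: the operator commutes with all time delays. -/
def IsTimeInvariant {d : ℕ} (F : Input d → ℤ → ℝ) : Prop :=
  ∀ (u : Input d) (τ t : ℤ), F (fun k => u (k - τ)) t = F u (t - τ)

/-- Continuity (fading memory property): the operator is uniformly bounded, and continuous for
the product topologies (which are the instances on these function types). -/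
def IsContinuousOperator {d : ℕ} (F : Input d → ℤ → ℝ) : Prop :=
  (∃ K > 0, ∀ u t, |F u t| ≤ K) ∧ Continuous F

/-- Extension of a left infinite sequence to a bi-infinite one, by `0` at positive times. -/
def extendPast {d : ℕ} (u : PastInput d) : Input d :=
  fun t => if t ≤ 0 then u (-t).toNat else fun _ => zeroBox

/-- The functional `F*` on left infinite sequences: the output at time `0`. For causal `F` the
choice of the extension is immaterial, see `functional_eq`. -/
def functional {d : ℕ} (F : Input d → ℤ → ℝ) (u : PastInput d) : ℝ := F (extendPast u) 0

theorem functional_eq {d : ℕ} {F : Input d → ℤ → ℝ} (hF : IsCausal F) (u : PastInput d)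
    (v : Input d) (hv : ∀ k : ℕ, v (-(k : ℤ)) = u k) : functional F u = F v 0 := by
  apply hF
  intro t ht
  have h := hv (-t).toNat
  rw [Int.toNat_of_nonneg (by omega), neg_neg] at h
  simp [extendPast, ht, h]

/-- The left infinite sequence `(…, 0, 0, x_1, …, x_m)`: the block `x` occupies the times
`-m+1, …, 0`, in this order. -/
def padZero {d : ℕ} (m : ℕ) (x : Fin m → Fin d → Box) : PastInput d :=
  fun k => if h : k < m then x ⟨m - 1 - k, by omega⟩ else fun _ => zeroBox

/-- The function `F*_m` on `([-1,1]^d)^m`. -/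
def finiteFunctional {d : ℕ} (F : Input d → ℤ → ℝ) (m : ℕ) (x : Fin m → Fin d → Box) : ℝ :=
  functional F (padZero m x)

/-- The block `u_{-m+1:0}` of the last `m` entries of a left infinite sequence. -/
def lastBlock {d : ℕ} (m : ℕ) (u : PastInput d) : Fin m → Fin d → Box :=
  fun i => u (m - 1 - i)

/-- The memory error `𝓔_F(m) = sup_u |F*(u) - F*_m(u_{-m+1:0})|`. For a bounded operator this is a
supremum of a bounded set of reals. -/
def memoryError {d : ℕ} (F : Input d → ℤ → ℝ) (m : ℕ) : ℝ :=
  ⨆ u : PastInput d, |functional F u - finiteFunctional F m (lastBlock m u)|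

/-- The ReLU function. -/
def relu (x : ℝ) : ℝ := max x 0

/-- The vectors of `ℝ^{md}`, as `m` blocks of `d` coordinates. -/
abbrev BlockVec (m d : ℕ) : Type := Fin m × Fin d → ℝ

/-- The cube `[-1/2,1/2]^{md}`. -/
def cube (m d : ℕ) : Set (BlockVec m d) := Set.univ.pi fun _ => Set.Icc (-(1 / 2)) (1 / 2)

/-- `F*_m` has an integral representation
`F*_m(x) = ∫_{-1/2}^{1/2} ∫_{[-1/2,1/2]^{md}} g(w,b) relu(w·x + b) dw db` on `[-1,1]^{md}`, with a
measurable function `g` that satisfies `|g| ≤ B`. -/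
def HasIntegralRepresentation {d : ℕ} (F : Input d → ℤ → ℝ) (m : ℕ) (B : ℝ) : Prop :=
  ∃ g : BlockVec m d → ℝ → ℝ,
    Measurable (fun p : BlockVec m d × ℝ => g p.1 p.2) ∧
    (∀ w ∈ cube m d, ∀ b ∈ Set.Icc (-(1 / 2) : ℝ) (1 / 2), |g w b| ≤ B) ∧
    ∀ x : Fin m → Fin d → Box,
      finiteFunctional F m x =
        ∫ b in Set.Icc (-(1 / 2) : ℝ) (1 / 2), ∫ w in cube m d,
          g w b * relu ((∑ p : Fin m × Fin d, w p * (x p.1 p.2 : ℝ)) + b)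

/-- The block shift matrix: identity blocks on the first block superdiagonal, `0` elsewhere. -/
def matP (m d : ℕ) : Matrix (Fin m × Fin d) (Fin m × Fin d) ℝ :=
  Matrix.of fun p q => if (p.1 : ℕ) + 1 = (q.1 : ℕ) ∧ p.2 = q.2 then 1 else 0

/-- The input matrix: the identity in the last block, `0` elsewhere. -/
def matQ (m d : ℕ) : Matrix (Fin m × Fin d) (Fin d) ℝ :=
  Matrix.of fun p j => if (p.1 : ℕ) + 1 = m ∧ p.2 = j then 1 else 0

/-- `s` solves `s_t = φ(W₁ s_{t-1} + W₂ u_t + b)` for all `t ≤ 0` (`φ` acts entrywise); the entries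
at time `-k` are stored at the index `k`. -/
def IsSolution {n d : ℕ} (φ : ℝ → ℝ) (W₁ : Matrix (Fin n) (Fin n) ℝ)
    (W₂ : Matrix (Fin n) (Fin d) ℝ) (b : Fin n → ℝ) (u : PastInput d)
    (s : ℕ → Fin n → ℝ) : Prop :=
  ∀ (k : ℕ) (i : Fin n),
    s k i = φ ((W₁.mulVec (s (k + 1)) + W₂.mulVec (fun j => (u k j : ℝ)) + b) i)

/-- Existence of solutions property of the system `s_t = φ(W₁ s_{t-1} + W₂ u_t + b)`. -/
def HasSolutions {n d : ℕ} (φ : ℝ → ℝ) (W₁ : Matrix (Fin n) (Fin n) ℝ)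
    (W₂ : Matrix (Fin n) (Fin d) ℝ) (b : Fin n → ℝ) : Prop :=
  ∀ u : PastInput d, ∃ s : ℕ → Fin n → ℝ, IsSolution φ W₁ W₂ b u s

/-- `H` is an operator associated to the network `s_t = φ(W₁ s_{t-1} + W₂ u_t + b)`, `y_t = a·s_t`:
it is causal and time-invariant, and for some choice of a solution `S u` for every left infinite
input `u`, the functional `H*` is `u ↦ a·(S u)_0`. -/
def IsAssociatedOperator {n d : ℕ} (φ : ℝ → ℝ) (W₁ : Matrix (Fin n) (Fin n) ℝ)
    (W₂ : Matrix (Fin n) (Fin d) ℝ) (b a : Fin n → ℝ) (H : Input d → ℤ → ℝ) : Prop :=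
  IsCausal H ∧ IsTimeInvariant H ∧
    ∃ S : PastInput d → ℕ → Fin n → ℝ,
      (∀ u, IsSolution φ W₁ W₂ b u (S u)) ∧ ∀ u, functional H u = a ⬝ᵥ S u 0

/-- The weight matrix `W ∈ ℝ^{n × md}` whose rows are the weight parts of the samples. -/
def weightMatrix {n m d : ℕ} (x : Fin n → BlockVec m d × ℝ) : Matrix (Fin n) (Fin m × Fin d) ℝ :=
  Matrix.of fun i => (x i).1

/-- The bias vector of the samples. -/
def biasVector {n m d : ℕ} (x : Fin n → BlockVec m d × ℝ) : Fin n → ℝ := fun i => (x i).2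

/-- The recurrent matrix `W ((24/n) P Wᵀ)`. -/
def recurrentMatrix {n m d : ℕ} (x : Fin n → BlockVec m d × ℝ) : Matrix (Fin n) (Fin n) ℝ :=
  weightMatrix x * ((24 / (n : ℝ)) • (matP m d * (weightMatrix x).transpose))

/-- The input matrix `W Q` of the network. -/
def inputMatrix {n m d : ℕ} (x : Fin n → BlockVec m d × ℝ) : Matrix (Fin n) (Fin d) ℝ :=
  weightMatrix x * matQ m d

/-- The factor `4 √(md+1) + √(log(4md/δ))`. -/
def logFactor (m d : ℕ) (δ : ℝ) : ℝ :=
  4 * √((m : ℝ) * d + 1) + √(Real.log (4 * m * d / δ))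

/-- The constant `C(m,δ,d)` in front of the rate; it is proportional to the bound `B`. -/
def constC (m d : ℕ) (δ B : ℝ) : ℝ :=
  √2 * B * (m * d + 1) * (3 * m ^ 2 * d + 1) * logFactor m d δ

/-- The threshold `c(m,δ,d)` for `n / log (n+1)`. -/
def thresholdC (m d : ℕ) (δ : ℝ) : ℝ :=
  1152 * m ^ 2 * (m * d + 1) ^ 2 * logFactor m d δ ^ 2

end ESN

end

/-! ### The uniform law on the parameter cube and its moments -/

namespace ESN

/-! Under the uniform law `w_j * relu (w·x + b)` has mean `x_j / 24` (`integral_fst_mul_relu`), so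
`x ↦ (24/n) Wᵀ relu(Wx + b)` is a Monte Carlo approximation of the identity. A state `relu(Wy + b)`
can thus be decoded to approximately `y`, and the recurrence becomes a perturbed shift register on
`ℝ^{md}` (`recurrentMatrix_mulVec_add`): `P` shifts the blocks, `Q` loads the newest input. If
decoding errs by at most `ε` on `[-2,2]^{md}` and `m ε ≤ 1`, the register never leaves that cube.
Compactness then gives left infinite orbits without any contraction (`exists_shiftStep_orbit`), and
the register at time `0` is within `m ε` of the last `m` inputs (`abs_orbit_sub_le`). The readout
`a_i = B h(w_i, b_i) / n`, with `B h` the representing density, is a Monte Carlo value of the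
integral for `F*_m` at that register. Both approximations follow from one uniform law of large
numbers (`exists_uniform_deviation_event`: Hoeffding on a grid, plus Lipschitz bounds), applied to
`h` and to the `md` weights `2 w_q`. With `t` the deviation rate, `ε = 12 t`; the error is at most
`B t + B (md/2) m ε` plus the memory error. -/

/-- The interval `[-1/2,1/2]`. -/
abbrev halfIcc : Set ℝ := Set.Icc (-(1 / 2)) (1 / 2)

/-- The cube `[-1/2,1/2]^{md+1}` of parameters `(w, b)`. -/
abbrev paramCube (m d : ℕ) : Set (BlockVec m d × ℝ) := cube m d ×ˢ halfIcc

/-- The uniform distribution on `[-1/2,1/2]`. -/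
noncomputable abbrev halfLaw : Measure ℝ := volume.restrict halfIcc

/-- The uniform distribution on `[-1/2,1/2]^{md+1}`. -/
noncomputable def paramLaw (m d : ℕ) : Measure (BlockVec m d × ℝ) :=
  (Measure.pi fun _ => halfLaw).prod halfLaw

instance isProbabilityMeasure_halfLaw : IsProbabilityMeasure halfLaw :=
  ⟨by simp only [Measure.restrict_apply MeasurableSet.univ, Set.univ_inter, Real.volume_Icc]
      norm_num⟩

instance isProbabilityMeasure_paramLaw (m d : ℕ) : IsProbabilityMeasure (paramLaw m d) := by
  unfold paramLaw; infer_instance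

theorem measurableSet_cube (m d : ℕ) : MeasurableSet (cube m d) :=
  MeasurableSet.univ_pi fun _ => measurableSet_Icc

theorem measurableSet_paramCube (m d : ℕ) : MeasurableSet (paramCube m d) :=
  (measurableSet_cube m d).prod measurableSet_Icc

theorem volume_restrict_cube (m d : ℕ) :
    (volume : Measure (BlockVec m d)).restrict (cube m d) = Measure.pi fun _ => halfLaw := by
  rw [volume_pi, cube, Measure.restrict_pi_pi]

theorem volume_restrict_paramCube (m d : ℕ) :
    (volume : Measure (BlockVec m d × ℝ)).restrict (paramCube m d) = paramLaw m d := by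
  rw [paramLaw, ← volume_restrict_cube, Measure.prod_restrict]
  rfl

theorem volume_paramCube (m d : ℕ) :
    (volume : Measure (BlockVec m d × ℝ)) (paramCube m d) = 1 := by
  have h : paramLaw m d Set.univ = 1 := measure_univ
  rwa [← volume_restrict_paramCube, Measure.restrict_apply_univ] at h

theorem map_eq_paramLaw {m d : ℕ} {Ω : Type*} [MeasurableSpace Ω] {μ : Measure Ω}
    {Y : Ω → BlockVec m d × ℝ} (h : pdf.IsUniform Y (paramCube m d) μ volume) :
    μ.map Y = paramLaw m d := by
  have h' : μ.map Y = ProbabilityTheory.cond volume (paramCube m d) := h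
  rw [h', ProbabilityTheory.cond, volume_paramCube, volume_restrict_paramCube, inv_one, one_smul]

theorem ae_mem_paramCube (m d : ℕ) : ∀ᵐ p ∂paramLaw m d, p ∈ paramCube m d := by
  rw [← volume_restrict_paramCube]
  exact ae_restrict_mem (measurableSet_paramCube m d)

/-- The affine function `w·x + b` of `x`, as a function of the parameters. -/
def affine {m d : ℕ} (x : BlockVec m d) (p : BlockVec m d × ℝ) : ℝ :=
  (∑ q, p.1 q * x q) + p.2

theorem measurable_affine {m d : ℕ} (x : BlockVec m d) : Measurable (affine x) := by
  unfold affine; fun_prop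

theorem continuous_affine_left {m d : ℕ} (p : BlockVec m d × ℝ) :
    Continuous fun x => affine x p := by
  unfold affine; fun_prop

theorem measurable_relu : Measurable relu := by
  unfold relu; fun_prop

theorem continuous_relu : Continuous relu := by
  unfold relu; fun_prop

theorem relu_sub_relu_neg (x : ℝ) : relu x - relu (-x) = x := by
  unfold relu
  rcases le_total x 0 with h | h
  · rw [max_eq_right h, max_eq_left (by linarith)]; ring
  · rw [max_eq_left h, max_eq_right (by linarith)]; ring

theorem abs_relu_le (x : ℝ) : |relu x| ≤ |x| := by
  unfold relu
  rw [abs_of_nonneg (le_max_right _ _)]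
  exact max_le (le_abs_self x) (abs_nonneg x)

theorem abs_relu_sub_relu_le (x y : ℝ) : |relu x - relu y| ≤ |x - y| :=
  abs_max_sub_max_le_abs x y 0

theorem abs_fst_le {m d : ℕ} {p : BlockVec m d × ℝ} (hp : p ∈ paramCube m d)
    (q : Fin m × Fin d) : |p.1 q| ≤ 1 / 2 :=
  abs_le.2 (hp.1 q (Set.mem_univ q))

theorem abs_snd_le {m d : ℕ} {p : BlockVec m d × ℝ} (hp : p ∈ paramCube m d) :
    |p.2| ≤ 1 / 2 :=
  abs_le.2 hp.2

theorem abs_sum_mul_le {m d : ℕ} {p : BlockVec m d × ℝ} (hp : p ∈ paramCube m d) {c : ℝ}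
    {x : BlockVec m d} (hx : ∀ q, |x q| ≤ c) :
    |∑ q, p.1 q * x q| ≤ m * d / 2 * c := by
  calc |∑ q, p.1 q * x q| ≤ ∑ q, |p.1 q * x q| := Finset.abs_sum_le_sum_abs _ _
    _ ≤ ∑ _q : Fin m × Fin d, 1 / 2 * c := by
        refine Finset.sum_le_sum fun q _ => ?_
        rw [abs_mul]
        exact mul_le_mul (abs_fst_le hp q) (hx q) (abs_nonneg _) (by norm_num)
    _ = m * d / 2 * c := by
        rw [Finset.sum_const, Finset.card_univ, Fintype.card_prod, Fintype.card_fin,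
          Fintype.card_fin, nsmul_eq_mul]
        push_cast; ring

theorem abs_affine_sub_le {m d : ℕ} {p : BlockVec m d × ℝ} (hp : p ∈ paramCube m d) {c : ℝ}
    {x y : BlockVec m d} (h : ∀ q, |x q - y q| ≤ c) :
    |affine x p - affine y p| ≤ m * d / 2 * c := by
  have e : affine x p - affine y p = ∑ q, p.1 q * (x - y) q := by
    simp only [affine, Pi.sub_apply, mul_sub, Finset.sum_sub_distrib]; ring
  rw [e]
  exact abs_sum_mul_le hp h

theorem abs_affine_le {m d : ℕ} {p : BlockVec m d × ℝ} (hp : p ∈ paramCube m d) {c : ℝ}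
    {x : BlockVec m d} (hx : ∀ q, |x q| ≤ c) : |affine x p| ≤ m * d / 2 * c + 1 / 2 :=
  (abs_add_le _ _).trans (add_le_add (abs_sum_mul_le hp hx) (abs_snd_le hp))

theorem exists_abs_affine_le {m d : ℕ} (x : BlockVec m d) :
    ∃ K, ∀ p ∈ paramCube m d, |affine x p| ≤ K :=
  ⟨_, fun _ hp => abs_affine_le hp fun q => Finset.single_le_sum (f := fun q => |x q|)
    (fun _ _ => abs_nonneg _) (Finset.mem_univ q)⟩

theorem integrable_paramLaw_of_bound {m d : ℕ} {f : BlockVec m d × ℝ → ℝ} (hf : Measurable f)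
    {K : ℝ} (h : ∀ p ∈ paramCube m d, |f p| ≤ K) : Integrable f (paramLaw m d) :=
  Integrable.of_bound hf.aestronglyMeasurable K ((ae_mem_paramCube m d).mono h)

theorem integrable_mul_relu {m d : ℕ} {h : BlockVec m d × ℝ → ℝ} (hm : Measurable h) {B : ℝ}
    (hb : ∀ p ∈ paramCube m d, |h p| ≤ B) (x : BlockVec m d) :
    Integrable (fun p => h p * relu (affine x p)) (paramLaw m d) := by
  obtain ⟨K, hK⟩ := exists_abs_affine_le x
  refine integrable_paramLaw_of_bound (hm.mul (measurable_relu.comp (measurable_affine x)))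
    (K := B * K) fun p hp => ?_
  rw [abs_mul]
  exact mul_le_mul (hb p hp) ((abs_relu_le _).trans (hK p hp)) (abs_nonneg _)
    ((abs_nonneg _).trans (hb p hp))

theorem measurePreserving_neg_halfLaw : MeasurePreserving (fun x : ℝ => -x) halfLaw halfLaw := by
  have h := (Measure.measurePreserving_neg (volume : Measure ℝ)).restrict_preimage
    (s := halfIcc) measurableSet_Icc
  have e : Neg.neg ⁻¹' halfIcc = halfIcc := by
    ext x; simp only [Set.mem_preimage, Set.mem_Icc]; constructor <;> rintro ⟨h₁, h₂⟩ <;>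
      constructor <;> linarith
  rwa [e] at h

theorem measurePreserving_neg_paramLaw (m d : ℕ) :
    MeasurePreserving (fun p : BlockVec m d × ℝ => -p) (paramLaw m d) (paramLaw m d) :=
  (measurePreserving_pi _ _ fun _ => measurePreserving_neg_halfLaw).prod
    measurePreserving_neg_halfLaw

/-- Changing the sign of one weight preserves the uniform distribution. -/
theorem measurePreserving_flip {m d : ℕ} (j : Fin m × Fin d) :
    MeasurePreserving
      (fun p : BlockVec m d × ℝ => ((fun q => if q = j then -p.1 q else p.1 q), p.2))
      (paramLaw m d) (paramLaw m d) := by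
  refine MeasurePreserving.prod (f := fun (w : BlockVec m d) q => if q = j then -w q else w q)
    (g := id) ?_ (MeasurePreserving.id _)
  refine measurePreserving_pi (fun _ => halfLaw) (fun _ => halfLaw)
    (f := fun q y => if q = j then -y else y) fun q => ?_
  by_cases hq : q = j
  · simpa [hq] using measurePreserving_neg_halfLaw
  · simp only [hq, if_false]
    exact MeasurePreserving.id _

theorem integral_sq_halfLaw : ∫ y, y * y ∂halfLaw = 1 / 12 := by
  rw [integral_Icc_eq_integral_Ioc, ← intervalIntegral.integral_of_le (by norm_num)]
  have : (fun y : ℝ => y * y) = fun y => y ^ 2 := by ext; ring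
  rw [this, integral_pow]
  norm_num

/-- Off the diagonal, flipping the sign of the weight `j` shows that the integral equals its own
negative. -/
theorem integral_fst_mul_fst {m d : ℕ} (j k : Fin m × Fin d) :
    ∫ p, p.1 j * p.1 k ∂paramLaw m d = if k = j then 1 / 12 else 0 := by
  split_ifs with h
  · subst h
    have hp : MeasurePreserving (fun p : BlockVec m d × ℝ => p.1 k) (paramLaw m d) halfLaw :=
      (measurePreserving_eval (fun _ => halfLaw) k).comp measurePreserving_fst
    rw [← integral_sq_halfLaw, ← hp.map_eq,
      integral_map hp.measurable.aemeasurable (by fun_prop)]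
  · have hp := measurePreserving_flip (m := m) (d := d) j
    have e := integral_map (μ := paramLaw m d) hp.measurable.aemeasurable
      (f := fun p => p.1 j * p.1 k) (by fun_prop)
    rw [hp.map_eq] at e
    simp only [if_true, if_neg h, neg_mul, integral_neg] at e
    linarith

theorem integral_fst_mul_snd {m d : ℕ} (j : Fin m × Fin d) :
    ∫ p, p.1 j * p.2 ∂paramLaw m d = 0 := by
  have hp := measurePreserving_flip (m := m) (d := d) j
  have e := integral_map (μ := paramLaw m d) hp.measurable.aemeasurable
    (f := fun p => p.1 j * p.2) (by fun_prop)
  rw [hp.map_eq] at e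
  simp only [if_true, neg_mul, integral_neg] at e
  linarith

theorem integral_fst_mul_affine {m d : ℕ} (x : BlockVec m d) (j : Fin m × Fin d) :
    ∫ p, p.1 j * affine x p ∂paramLaw m d = x j / 12 := by
  have h₁ : ∀ k, Integrable (fun p => p.1 j * p.1 k) (paramLaw m d) := fun k =>
    integrable_paramLaw_of_bound (by fun_prop) (K := 1 / 2 * (1 / 2)) fun p hp => by
      rw [abs_mul]
      exact mul_le_mul (abs_fst_le hp j) (abs_fst_le hp k) (abs_nonneg _) (by norm_num)
  have h₂ : Integrable (fun p => p.1 j * p.2) (paramLaw m d) :=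
    integrable_paramLaw_of_bound (by fun_prop) (K := 1 / 2 * (1 / 2)) fun p hp => by
      rw [abs_mul]
      exact mul_le_mul (abs_fst_le hp j) (abs_snd_le hp) (abs_nonneg _) (by norm_num)
  have e : (fun p : BlockVec m d × ℝ => p.1 j * affine x p) =
      fun p => (∑ k, p.1 j * p.1 k * x k) + p.1 j * p.2 := by
    ext p; simp only [affine, mul_add, Finset.mul_sum, mul_assoc]
  rw [e, integral_add (integrable_finsetSum _ fun k _ => (h₁ k).mul_const _) h₂,
    integral_finsetSum _ fun k _ => (h₁ k).mul_const _, integral_fst_mul_snd]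
  simp only [integral_mul_const, integral_fst_mul_fst]
  simp
  ring

/-- Since `relu z - relu (-z) = z`, the weighted mean of a random ReLU feature is linear. -/
theorem integral_fst_mul_relu {m d : ℕ} (x : BlockVec m d) (j : Fin m × Fin d) :
    ∫ p, p.1 j * relu (affine x p) ∂paramLaw m d = x j / 24 := by
  have hi : Integrable (fun p => p.1 j * relu (affine x p)) (paramLaw m d) :=
    integrable_mul_relu (by fun_prop) (fun p hp => abs_fst_le hp j) x
  have hp := measurePreserving_neg_paramLaw m d
  have hneg : ∀ p : BlockVec m d × ℝ, affine x (-p) = -affine x p := fun p => by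
    simp [affine, Finset.sum_neg_distrib]; ring
  have e := integral_map (μ := paramLaw m d) hp.measurable.aemeasurable
    (f := fun p => p.1 j * relu (affine x p)) (by rw [hp.map_eq]; exact hi.1)
  have hi' : Integrable (fun p : BlockVec m d × ℝ => (-p).1 j * relu (affine x (-p)))
      (paramLaw m d) := hp.integrable_comp_of_integrable hi
  rw [hp.map_eq] at e
  -- Adding the integrand to its reflection under `p ↦ -p` removes the ReLU; both have the same
  -- integral, so halving `x j / 12` gives `x j / 24`.
  have s := integral_add hi hi'
  have e' : (fun p : BlockVec m d × ℝ =>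
      p.1 j * relu (affine x p) + (-p).1 j * relu (affine x (-p))) =
      fun p => p.1 j * affine x p := by
    ext p
    conv_rhs => rw [← relu_sub_relu_neg (affine x p)]
    rw [hneg]
    simp only [Prod.fst_neg, Pi.neg_apply]
    ring
  rw [e', integral_fst_mul_affine] at s
  linarith

theorem setIntegral_setIntegral_eq {m d : ℕ} {f : BlockVec m d × ℝ → ℝ}
    (hf : Integrable f (paramLaw m d)) :
    ∫ b in halfIcc, ∫ w in cube m d, f (w, b) = ∫ p, f p ∂paramLaw m d := by
  rw [volume_restrict_cube, paramLaw, integral_prod_symm f hf]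

end ESN

/-! ### Uniform law of large numbers for random ReLU features -/

namespace ESN

/-- Two-sided Hoeffding inequality for the mean of bounded independent variables. -/
theorem measureReal_abs_mean_sub_ge_le {Ω : Type*} [MeasurableSpace Ω] {μ : Measure Ω}
    [IsProbabilityMeasure μ] {n : ℕ} (hn : 1 ≤ n) {Y : Fin n → Ω → ℝ}
    (hm : ∀ i, Measurable (Y i)) (hY : iIndepFun Y μ) {c : ℝ} (hc : 0 < c)
    (hb : ∀ i, ∀ᵐ ω ∂μ, |Y i ω| ≤ c) {e : ℝ} (he : ∀ i, ∫ ω, Y i ω ∂μ = e)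
    {s : ℝ} (hs : 0 ≤ s) :
    μ.real {ω | s ≤ |(∑ i, Y i ω) / n - e|} ≤ 2 * Real.exp (-(n * s ^ 2 / (2 * c ^ 2))) := by
  have hn0 : (0 : ℝ) < n := by exact_mod_cast hn
  have key : ∀ Z : Fin n → Ω → ℝ, (∀ i, Measurable (Z i)) → iIndepFun Z μ →
      (∀ i, ∀ᵐ ω ∂μ, |Z i ω| ≤ c) →
      μ.real {ω | n * s ≤ ∑ i, (Z i ω - ∫ ω, Z i ω ∂μ)} ≤
        Real.exp (-(n * s ^ 2 / (2 * c ^ 2))) := by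
    intro Z hZm hZ hZb
    have hind : iIndepFun (fun i ω => Z i ω - ∫ ω, Z i ω ∂μ) μ :=
      hZ.comp (fun i y => y - ∫ ω, Z i ω ∂μ) fun i => by fun_prop
    have h := HasSubgaussianMGF.measure_sum_ge_le_of_iIndepFun hind (s := Finset.univ)
      (fun i _ => hasSubgaussianMGF_of_mem_Icc (hZm i).aemeasurable
        ((hZb i).mono fun ω h => abs_le.1 h)) (mul_nonneg hn0.le hs)
    refine h.trans (le_of_eq ?_)
    congr 1
    -- A variable in `[-c, c]` is sub-Gaussian with parameter `(2c/2)^2 = c^2`, so the exponent is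
    -- `(ns)^2 / (2 n c^2)`.
    have : ‖c - -c‖ = 2 * c := by
      rw [Real.norm_eq_abs, abs_of_pos (by linarith)]; ring
    simp only [Finset.sum_const, Finset.card_univ, Fintype.card_fin, nsmul_eq_mul]
    push_cast
    rw [this]
    field_simp
  have h₁ := key Y hm hY hb
  have h₂ := key (fun i ω => -Y i ω) (fun i => (hm i).neg)
    (hY.comp (fun _ y => -y) fun _ => measurable_neg) (fun i => by simpa using hb i)
  have hsub : {ω | s ≤ |(∑ i, Y i ω) / n - e|} ⊆
      {ω | n * s ≤ ∑ i, (Y i ω - ∫ ω, Y i ω ∂μ)} ∪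
      {ω | n * s ≤ ∑ i, (-Y i ω - ∫ ω, -Y i ω ∂μ)} := by
    intro ω hω
    simp only [Set.mem_ofPred_eq, Set.mem_union, integral_neg, he, Finset.sum_sub_distrib,
      Finset.sum_neg_distrib, Finset.sum_const, Finset.card_univ, Fintype.card_fin,
      nsmul_eq_mul] at hω ⊢
    have e₁ : ∑ i, Y i ω = n * ((∑ i, Y i ω) / n) := by field_simp
    rw [e₁]
    rcases le_abs.1 hω with h | h
    · left; nlinarith
    · right; nlinarith
  calc _ ≤ _ := measureReal_mono hsub
    _ ≤ _ := measureReal_union_le _ _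
    _ ≤ _ := by linarith

/-- The points of the grid of mesh `1/n` in `[-2,2]^{md}`. -/
noncomputable def gridPoint {m d : ℕ} (n : ℕ) (k : Fin m × Fin d → Fin (4 * n + 1)) :
    BlockVec m d :=
  fun q => (k q : ℕ) / (n : ℝ) - 2

theorem abs_gridPoint_le {m d n : ℕ} (hn : 1 ≤ n) (k : Fin m × Fin d → Fin (4 * n + 1))
    (q : Fin m × Fin d) : |gridPoint n k q| ≤ 2 := by
  have hn0 : (0 : ℝ) < n := by exact_mod_cast hn
  have h : ((k q : ℕ) : ℝ) ≤ 4 * n := by exact_mod_cast Nat.lt_succ_iff.1 (k q).2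
  have h' : ((k q : ℕ) : ℝ) / n ≤ 4 := (div_le_iff₀ hn0).2 h
  have h'' : 0 ≤ ((k q : ℕ) : ℝ) / n := by positivity
  rw [gridPoint, abs_le]
  constructor <;> linarith

/-- Each coordinate is rounded down to the grid; including both endpoints of `[-2,2]` requires `4n +
1` values. -/
theorem exists_gridPoint_close {m d n : ℕ} (hn : 1 ≤ n) {x : BlockVec m d}
    (hx : ∀ q, |x q| ≤ 2) :
    ∃ k : Fin m × Fin d → Fin (4 * n + 1), ∀ q, |x q - gridPoint n k q| ≤ 1 / n := by
  have hn0 : (0 : ℝ) < n := by exact_mod_cast hn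
  have hlt : ∀ q, ⌊(x q + 2) * n⌋₊ < 4 * n + 1 := fun q => by
    refine Nat.lt_succ_of_le (Nat.floor_le_of_le ?_)
    push_cast
    exact mul_le_mul_of_nonneg_right (by linarith [(abs_le.1 (hx q)).2]) hn0.le
  refine ⟨fun q => ⟨_, hlt q⟩, fun q => ?_⟩
  have h0 : 0 ≤ (x q + 2) * n := mul_nonneg (by linarith [(abs_le.1 (hx q)).1]) hn0.le
  have h₁ := Nat.floor_le h0
  have h₂ := Nat.lt_floor_add_one ((x q + 2) * n)
  have e : x q - gridPoint n (fun q => (⟨_, hlt q⟩ : Fin (4 * n + 1))) q =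
      ((x q + 2) * n - ⌊(x q + 2) * n⌋₊) / n := by
    simp only [gridPoint]
    field_simp
    ring
  rw [e, abs_of_nonneg (div_nonneg (by linarith) hn0.le)]
  exact div_le_div_of_nonneg_right (by linarith) hn0.le

/-- The empirical mean of the random features `h(w,b) relu(w·x + b)`. -/
noncomputable def empiricalMean {n m d : ℕ} (X : Fin n → BlockVec m d × ℝ)
    (h : BlockVec m d × ℝ → ℝ) (x : BlockVec m d) : ℝ :=
  (∑ i, h (X i) * relu (affine x (X i))) / n

/-- The expectation of the random feature `h(w,b) relu(w·x + b)`. -/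
noncomputable def featureMean {m d : ℕ} (h : BlockVec m d × ℝ → ℝ) (x : BlockVec m d) : ℝ :=
  ∫ p, h p * relu (affine x p) ∂paramLaw m d

theorem abs_feature_sub_le {m d : ℕ} {h : BlockVec m d × ℝ → ℝ} {B : ℝ}
    {p : BlockVec m d × ℝ} (hp : p ∈ paramCube m d) (hb : |h p| ≤ B) {c : ℝ}
    {x y : BlockVec m d} (hxy : ∀ q, |x q - y q| ≤ c) :
    |h p * relu (affine x p) - h p * relu (affine y p)| ≤ B * (m * d / 2 * c) := by
  rw [← mul_sub, abs_mul]
  exact mul_le_mul hb ((abs_relu_sub_relu_le _ _).trans (abs_affine_sub_le hp hxy))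
    (abs_nonneg _) ((abs_nonneg _).trans hb)

theorem abs_empiricalMean_sub_le {n m d : ℕ} (hn : 1 ≤ n) {X : Fin n → BlockVec m d × ℝ}
    (hX : ∀ i, X i ∈ paramCube m d) {h : BlockVec m d × ℝ → ℝ} {B : ℝ}
    (hb : ∀ p ∈ paramCube m d, |h p| ≤ B) {c : ℝ}
    {x y : BlockVec m d} (hxy : ∀ q, |x q - y q| ≤ c) :
    |empiricalMean X h x - empiricalMean X h y| ≤ B * (m * d / 2 * c) := by
  have hn0 : (0 : ℝ) < n := by exact_mod_cast hn
  rw [empiricalMean, empiricalMean, ← sub_div, ← Finset.sum_sub_distrib, abs_div,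
    abs_of_pos hn0, div_le_iff₀ hn0]
  calc _ ≤ ∑ i, |h (X i) * relu (affine x (X i)) - h (X i) * relu (affine y (X i))| :=
        Finset.abs_sum_le_sum_abs _ _
    _ ≤ ∑ _i : Fin n, B * (m * d / 2 * c) :=
        Finset.sum_le_sum fun i _ => abs_feature_sub_le (hX i) (hb _ (hX i)) hxy
    _ = _ := by simp [mul_comm]

theorem abs_featureMean_sub_le {m d : ℕ} {h : BlockVec m d × ℝ → ℝ} (hm : Measurable h) {B : ℝ}
    (hb : ∀ p ∈ paramCube m d, |h p| ≤ B) {c : ℝ}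
    {x y : BlockVec m d} (hxy : ∀ q, |x q - y q| ≤ c) :
    |featureMean h x - featureMean h y| ≤ B * (m * d / 2 * c) := by
  rw [featureMean, featureMean,
    ← integral_sub (integrable_mul_relu hm hb x) (integrable_mul_relu hm hb y)]
  have := norm_integral_le_of_norm_le_const (μ := paramLaw m d)
    (f := fun p => h p * relu (affine x p) - h p * relu (affine y p)) ((ae_mem_paramCube m d).mono fun p hp => abs_feature_sub_le hp (hb p hp) hxy)
  simpa using this

/-- Off an event of small probability, the empirical means of the features are close to their
expectations uniformly on `[-2,2]^{md}`. -/
theorem exists_uniform_deviation_event {Ω : Type*} [MeasurableSpace Ω] {μ : Measure Ω}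
    [IsProbabilityMeasure μ] {n m d : ℕ} (hn : 1 ≤ n) {X : Fin n → Ω → BlockVec m d × ℝ}
    (hX : ∀ i, Measurable (X i)) (hindep : iIndepFun X μ)
    (hlaw : ∀ i, μ.map (X i) = paramLaw m d) {h : BlockVec m d × ℝ → ℝ} (hm : Measurable h)
    (hb : ∀ p ∈ paramCube m d, |h p| ≤ 1) {s : ℝ} (hs : 0 ≤ s) :
    ∃ E : Set Ω, MeasurableSet E ∧
      μ.real Eᶜ ≤
        (4 * n + 1) ^ (m * d) * (2 * Real.exp (-(n * s ^ 2 / (2 * ((m : ℝ) * d + 1) ^ 2)))) ∧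
      ∀ ω ∈ E, (∀ i, X i ω ∈ paramCube m d) → ∀ x : BlockVec m d, (∀ q, |x q| ≤ 2) →
        |empiricalMean (fun i => X i ω) h x - featureMean h x| ≤ s + m * d / n := by
  have hf : ∀ x : BlockVec m d, Measurable fun p => h p * relu (affine x p) := fun x =>
    hm.mul (measurable_relu.comp (measurable_affine x))
  have hemp : ∀ x : BlockVec m d, Measurable fun ω => empiricalMean (fun i => X i ω) h x :=
    fun x => (Finset.measurable_sum _ fun i _ => (hf x).comp (hX i)).div_const _
  have hcube : ∀ i, ∀ᵐ ω ∂μ, X i ω ∈ paramCube m d := fun i => by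
    have := ae_mem_paramCube m d
    rw [← hlaw i] at this
    exact ae_of_ae_map (hX i).aemeasurable this
  let E : Set Ω := ⋂ k : Fin m × Fin d → Fin (4 * n + 1),
    {ω | |empiricalMean (fun i => X i ω) h (gridPoint n k) - featureMean h (gridPoint n k)| < s}
  refine ⟨E, ?_, ?_, ?_⟩
  · exact MeasurableSet.iInter fun k =>
      measurableSet_lt ((hemp _).sub_const _).norm measurable_const
  · have hk : ∀ k : Fin m × Fin d → Fin (4 * n + 1),
        μ.real {ω | s ≤ |empiricalMean (fun i => X i ω) h (gridPoint n k) -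
          featureMean h (gridPoint n k)|} ≤
        2 * Real.exp (-(n * s ^ 2 / (2 * ((m : ℝ) * d + 1) ^ 2))) := fun k => by
      refine measureReal_abs_mean_sub_ge_le hn
        (Y := fun i ω => h (X i ω) * relu (affine (gridPoint n k) (X i ω)))
        (fun i => (hf _).comp (hX i)) (hindep.comp (fun _ => _) fun _ => hf (gridPoint n k))
        (by positivity) (fun i => ?_) (fun i => ?_) hs
      · filter_upwards [hcube i] with ω hω
        rw [abs_mul]
        -- On `[-2,2]^{md}` the feature is at most `md + 1/2`; rounding up to `md + 1` gives the
        -- Hoeffding constant.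
        have h₁ := (abs_relu_le _).trans (abs_affine_le hω (abs_gridPoint_le hn k))
        have h₂ := mul_le_mul (hb _ hω) h₁ (abs_nonneg _) zero_le_one
        linarith
      · rw [featureMean, ← hlaw i]
        exact (integral_map (hX i).aemeasurable (hf _).aestronglyMeasurable).symm
    have hcompl : Eᶜ = ⋃ k : Fin m × Fin d → Fin (4 * n + 1),
        {ω | s ≤ |empiricalMean (fun i => X i ω) h (gridPoint n k) -
          featureMean h (gridPoint n k)|} := by
      ext ω; simp [E]
    rw [hcompl]
    refine (measureReal_iUnion_fintype_le _).trans ((Finset.sum_le_sum fun k _ => hk k).trans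
      (le_of_eq ?_))
    simp
  · intro ω hω hc x hx
    obtain ⟨k, hk⟩ := exists_gridPoint_close hn hx
    have h₁ := abs_empiricalMean_sub_le hn hc hb hk
    have h₂ := abs_featureMean_sub_le hm hb hk
    have h₃ : |_| < s := Set.mem_iInter.1 hω k
    -- Moving to the nearby grid point costs `md / (2n)` twice, for the empirical mean and for the
    -- expectation.
    have e : 1 * ((m : ℝ) * d / 2 * (1 / n)) + 1 * (m * d / 2 * (1 / n)) = m * d / n := by ring
    rw [← e]
    rw [abs_le] at h₁ h₂ ⊢
    rw [abs_lt] at h₃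
    constructor <;> linarith [h₁.1, h₁.2, h₂.1, h₂.2, h₃.1, h₃.2]

end ESN

/-! ### Numerical estimates for the rate and the threshold -/

namespace ESN

/-- The uniform deviation of the empirical means of features with `|h| ≤ 1`. -/
noncomputable def deviationRate (n m d : ℕ) (δ : ℝ) : ℝ :=
  (m * d + 1) * logFactor m d δ * √(Real.log ((n : ℝ) + 1) / n) / √2

section Rates

variable {n m d : ℕ} {δ : ℝ}

theorem one_le_mul_cast (hm : 1 ≤ m) (hd : 1 ≤ d) : (1 : ℝ) ≤ m * d := by
  exact_mod_cast Nat.mul_le_mul hm hd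

theorem log_div_pos (hm : 1 ≤ m) (hd : 1 ≤ d) (hδ0 : 0 < δ) (hδ1 : δ < 1) :
    0 < Real.log (4 * m * d / δ) := by
  have h := one_le_mul_cast hm hd
  refine Real.log_pos ((lt_div_iff₀ hδ0).2 ?_)
  nlinarith

theorem le_logFactor_sq (hm : 1 ≤ m) (hd : 1 ≤ d) (hδ0 : 0 < δ) (hδ1 : δ < 1) :
    16 * ((m : ℝ) * d + 1) + Real.log (4 * m * d / δ) ≤ logFactor m d δ ^ 2 := by
  have h₁ : √((m : ℝ) * d + 1) ^ 2 = m * d + 1 := Real.sq_sqrt (by positivity)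
  have h₂ := Real.sq_sqrt (log_div_pos hm hd hδ0 hδ1).le
  have h₃ := mul_nonneg (Real.sqrt_nonneg ((m : ℝ) * d + 1))
    (Real.sqrt_nonneg (Real.log (4 * m * d / δ)))
  rw [logFactor]
  nlinarith

theorem four_le_logFactor (m d : ℕ) (δ : ℝ) : 4 ≤ logFactor m d δ := by
  have h : 1 ≤ √((m : ℝ) * d + 1) :=
    Real.one_le_sqrt.2 (by have : (0 : ℝ) ≤ m * d := by positivity
                           linarith)
  have := Real.sqrt_nonneg (Real.log (4 * m * d / δ))
  rw [logFactor]
  linarith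

theorem log_succ_pos (hn : 1 ≤ n) : 0 < Real.log ((n : ℝ) + 1) :=
  Real.log_pos (by have : (1 : ℝ) ≤ n := by exact_mod_cast hn
                   linarith)

/-- The threshold is at least `1152 * 16 = 18432`, so `n ≥ 18432 log 2 > e^8`. The value `8` serves
to absorb the grid mesh and the term `log(4md/δ)` below. -/
theorem eight_le_log (hn : 1 ≤ n) (hm : 1 ≤ m)
    (hlarge : thresholdC m d δ ≤ (n : ℝ) / Real.log ((n : ℝ) + 1)) :
    8 ≤ Real.log ((n : ℝ) + 1) := by
  have hlog := log_succ_pos hn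
  have hn1 : (1 : ℝ) ≤ n := by exact_mod_cast hn
  have hm1 : (1 : ℝ) ≤ (m : ℝ) ^ 2 := one_le_pow₀ (by exact_mod_cast hm)
  have hN : (1 : ℝ) ≤ ((m : ℝ) * d + 1) ^ 2 := one_le_pow₀ (by
    have : (0 : ℝ) ≤ m * d := by positivity
    linarith)
  have hL : (16 : ℝ) ≤ logFactor m d δ ^ 2 := by
    have := four_le_logFactor m d δ
    nlinarith
  have hc : 18432 ≤ thresholdC m d δ := by
    rw [thresholdC]
    calc (18432 : ℝ) = 1152 * 1 * 1 * 16 := by norm_num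
      _ ≤ _ := by gcongr
  have h₁ : 18432 * Real.log ((n : ℝ) + 1) ≤ n := (le_div_iff₀ hlog).1 (hc.trans hlarge)
  have h₂ : Real.log 2 ≤ Real.log ((n : ℝ) + 1) := Real.log_le_log (by norm_num) (by linarith)
  have h₃ := Real.log_two_gt_d9
  rw [Real.le_log_iff_exp_le (by linarith)]
  have h₄ : Real.exp 8 = Real.exp 1 ^ 8 := by rw [← Real.exp_nat_mul]; norm_num
  have h₅ : Real.exp 1 ^ 8 ≤ 2.72 ^ 8 :=
    pow_le_pow_left₀ (Real.exp_pos 1).le (by linarith [Real.exp_one_lt_d9]) 8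
  rw [h₄]
  refine h₅.trans ?_
  norm_num
  linarith

theorem deviationRate_nonneg (n m d : ℕ) (δ : ℝ) : 0 ≤ deviationRate n m d δ := by
  have := four_le_logFactor m d δ
  unfold deviationRate
  positivity

theorem deviationRate_sq (hn : 1 ≤ n) :
    n * deviationRate n m d δ ^ 2 =
      ((m : ℝ) * d + 1) ^ 2 * logFactor m d δ ^ 2 * Real.log ((n : ℝ) + 1) / 2 := by
  have hn0 : (0 : ℝ) < n := by exact_mod_cast hn
  have h₁ : √(Real.log ((n : ℝ) + 1) / n) ^ 2 = Real.log ((n : ℝ) + 1) / n :=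
    Real.sq_sqrt (div_nonneg (log_succ_pos hn).le hn0.le)
  rw [deviationRate, div_pow, mul_pow, mul_pow, h₁, Real.sq_sqrt (by norm_num)]
  field_simp

/-- This keeps the register, whose decoding error is `12 t`, inside `[-2,2]^{md}`. Squaring shows
that `72` would suffice in place of `1152`. -/
theorem mul_deviationRate_le_one (hn : 1 ≤ n)
    (hlarge : thresholdC m d δ ≤ (n : ℝ) / Real.log ((n : ℝ) + 1)) :
    m * (12 * deviationRate n m d δ) ≤ 1 := by
  have hn0 : (0 : ℝ) < n := by exact_mod_cast hn
  have h := deviationRate_sq (m := m) (d := d) (δ := δ) hn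
  rw [le_div_iff₀ (log_succ_pos hn), thresholdC] at hlarge
  have h₂ : n * (m * (12 * deviationRate n m d δ)) ^ 2 ≤ n * 1 := by
    calc (n : ℝ) * (m * (12 * deviationRate n m d δ)) ^ 2
        = 144 * m ^ 2 * (n * deviationRate n m d δ ^ 2) := by ring
      _ = 1152 * m ^ 2 * (m * d + 1) ^ 2 * logFactor m d δ ^ 2 * Real.log ((n : ℝ) + 1) / 16 := by
          rw [h]; ring
      _ ≤ n * 1 := by linarith
  have h₃ := le_of_mul_le_mul_left h₂ hn0
  exact (sq_le_one_iff₀ (by have := deviationRate_nonneg n m d δ; positivity)).1 h₃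

theorem mesh_le_deviationRate (hn : 1 ≤ n) (hlog : 8 ≤ Real.log ((n : ℝ) + 1)) :
    (m : ℝ) * d / n ≤ deviationRate n m d δ / 4 := by
  have hn0 : (0 : ℝ) < n := by exact_mod_cast hn
  have hn1 : (1 : ℝ) ≤ n := by exact_mod_cast hn
  have h := deviationRate_sq (m := m) (d := d) (δ := δ) hn
  have hL : (16 : ℝ) ≤ logFactor m d δ ^ 2 := by
    have := four_le_logFactor m d δ
    nlinarith
  refine le_of_sq_le_sq ?_ (div_nonneg (deviationRate_nonneg n m d δ) (by norm_num))
  have h₁ : ((m : ℝ) * d + 1) ^ 2 * 16 * 8 / 2 ≤ n * deviationRate n m d δ ^ 2 := by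
    rw [h]; gcongr
  have h₂ : ((m : ℝ) * d) ^ 2 ≤ ((m : ℝ) * d + 1) ^ 2 := by gcongr; linarith
  have h₃ : 0 ≤ ((m : ℝ) * d + 1) ^ 2 := by positivity
  rw [div_pow, div_le_iff₀ (by positivity), div_pow]
  have h₄ : n * deviationRate n m d δ ^ 2 ≤ n * (n * deviationRate n m d δ ^ 2) :=
    le_mul_of_one_le_left (by positivity) hn1
  have e : deviationRate n m d δ ^ 2 / 4 ^ 2 * (n : ℝ) ^ 2 =
    (n * (n * deviationRate n m d δ ^ 2)) / 16 := by ring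
  rw [e]
  linarith

/-- The deviation at grid points is allowed `3/4` of the rate, the mesh taking the remaining
quarter. The exponent `(9/64) L^2 log(n+1)`, `L` the log factor, must pay for the grid and for `δ`:
`16 * 9/64 ≥ 2` covers `(n+1)^(2md)`, and `8 * 9/64 ≥ 1` covers `log(4md/δ)`. -/
theorem grid_tail_le (hn : 1 ≤ n) (hm : 1 ≤ m) (hd : 1 ≤ d) (hδ0 : 0 < δ) (hδ1 : δ < 1)
    (hlog : 8 ≤ Real.log ((n : ℝ) + 1)) :
    (4 * (n : ℝ) + 1) ^ (m * d) * (2 * Real.exp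
      (-(n * (3 / 4 * deviationRate n m d δ) ^ 2 / (2 * ((m : ℝ) * d + 1) ^ 2)))) ≤
      δ / (2 * (m * d)) := by
  have hD := one_le_mul_cast hm hd
  have hD0 : (0 : ℝ) < m * d := by linarith
  have hℓ := log_div_pos hm hd hδ0 hδ1
  have hn0 : (0 : ℝ) < n := by exact_mod_cast hn
  -- Needed for `4n + 1 ≤ (n+1)^2`, which fails at `n = 1`.
  have hn2 : (2 : ℝ) ≤ n := by
    have : 2 ≤ n := by
      by_contra hlt
      have h1 : n = 1 := by omega
      subst h1
      have := Real.log_two_lt_d9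
      norm_num at hlog
      linarith
    exact_mod_cast this
  have e : n * (3 / 4 * deviationRate n m d δ) ^ 2 / (2 * ((m : ℝ) * d + 1) ^ 2) =
      9 / 64 * logFactor m d δ ^ 2 * Real.log ((n : ℝ) + 1) := by
    have h := deviationRate_sq (m := m) (d := d) (δ := δ) hn
    rw [mul_pow, mul_left_comm, h]
    field_simp
    ring
  have hexp : Real.log ((n : ℝ) + 1) * ((2 * (m * d) : ℕ) : ℝ) + Real.log (4 * m * d / δ) ≤
      9 / 64 * logFactor m d δ ^ 2 * Real.log ((n : ℝ) + 1) := by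
    have h₁ := mul_le_mul_of_nonneg_right (le_logFactor_sq hm hd hδ0 hδ1)
      (show 0 ≤ Real.log ((n : ℝ) + 1) by linarith)
    have h₂ := mul_le_mul_of_nonneg_left hlog hℓ.le
    push_cast
    nlinarith
  rw [e]
  have h₁ : Real.exp (-(9 / 64 * logFactor m d δ ^ 2 * Real.log ((n : ℝ) + 1))) ≤
      (((n : ℝ) + 1) ^ (2 * (m * d)))⁻¹ * (δ / (4 * m * d)) := by
    refine (Real.exp_le_exp.2 (neg_le_neg hexp)).trans (le_of_eq ?_)
    rw [neg_add, Real.exp_add, Real.exp_neg, Real.exp_neg, Real.exp_log (by positivity), inv_div,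
      mul_comm (Real.log _), Real.exp_nat_mul, Real.exp_log (by linarith)]
  have h₂ : (4 * (n : ℝ) + 1) ^ (m * d) ≤ ((n : ℝ) + 1) ^ (2 * (m * d)) := by
    rw [pow_mul ((n : ℝ) + 1)]
    exact pow_le_pow_left₀ (by positivity) (by nlinarith) _
  calc _ ≤ ((n : ℝ) + 1) ^ (2 * (m * d)) *
        (2 * ((((n : ℝ) + 1) ^ (2 * (m * d)))⁻¹ * (δ / (4 * m * d)))) := by gcongr
    _ = δ / (2 * (m * d)) := by
      have : (0 : ℝ) < m := by exact_mod_cast hm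
      have : (0 : ℝ) < d := by exact_mod_cast hd
      field_simp
      norm_num

theorem mul_deviationRate_le_constC {B : ℝ} (hB : 0 ≤ B) :
    B * deviationRate n m d δ + B * (m * d / 2 * (m * (12 * deviationRate n m d δ))) ≤
      constC m d δ B * √(Real.log ((n : ℝ) + 1) / n) := by
  have h2 : √2 * √2 = (2 : ℝ) := Real.mul_self_sqrt (by norm_num)
  have e : deviationRate n m d δ =
      √2 * ((m * d + 1) * logFactor m d δ * √(Real.log ((n : ℝ) + 1) / n)) / 2 := by
    rw [deviationRate, div_eq_div_iff (by positivity) (by norm_num)]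
    linear_combination
      -((m * d + 1) * logFactor m d δ * √(Real.log ((n : ℝ) + 1) / n)) * h2
  have hr := deviationRate_nonneg n m d δ
  have e' : constC m d δ B * √(Real.log ((n : ℝ) + 1) / n) =
      2 * B * deviationRate n m d δ * (3 * m ^ 2 * d + 1) := by
    rw [e, constC]; ring
  rw [e']
  nlinarith [mul_nonneg hB hr]

end Rates

end ESN

/-! ### Perturbed shift registers and solutions of the network -/

namespace ESN

/-- The shift register `y ↦ P G(y) + Q v` on `ℝ^{md}`. -/
def shiftStep {m d : ℕ} (G : BlockVec m d → BlockVec m d) (v : Fin d → ℝ) (y : BlockVec m d) :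
    BlockVec m d :=
  fun q => if h : (q.1 : ℕ) + 1 < m then G y (⟨q.1 + 1, h⟩, q.2) else v q.2

theorem matP_mulVec_add_matQ_mulVec {m d : ℕ} (g : BlockVec m d) (v : Fin d → ℝ)
    (q : Fin m × Fin d) :
    (matP m d).mulVec g q + (matQ m d).mulVec v q =
      if h : (q.1 : ℕ) + 1 < m then g (⟨q.1 + 1, h⟩, q.2) else v q.2 := by
  obtain ⟨j, i⟩ := q
  simp only [Matrix.mulVec, dotProduct, matP, matQ, Matrix.of_apply, ite_mul, one_mul, zero_mul]
  split_ifs with h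
  · have h₁ : ¬((j : ℕ) + 1 = m) := by omega
    rw [Finset.sum_eq_single ((⟨j + 1, h⟩, i) : Fin m × Fin d)]
    · simp [h₁]
    · rintro ⟨j', i'⟩ - hne
      refine if_neg fun hc => hne ?_
      exact Prod.ext (Fin.ext hc.1.symm) hc.2.symm
    · simp
  · have h₁ : (j : ℕ) + 1 = m := by omega
    simp [h₁, fun x : Fin m × Fin d => show ¬(m = (x.1 : ℕ)) from by have := x.1.2; omega]

theorem continuous_shiftStep {m d : ℕ} {G : BlockVec m d → BlockVec m d} (hG : Continuous G)
    (v : Fin d → ℝ) : Continuous (shiftStep G v) := by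
  refine continuous_pi fun q => ?_
  unfold shiftStep
  split_ifs with h
  · exact (continuous_apply _).comp hG
  · exact continuous_const

section ShiftRegister

variable {m d : ℕ} {G : BlockVec m d → BlockVec m d} {ε : ℝ}

/-- The block at distance `r` from the last one is bounded by `1 + r ε`. -/
def registerSet (m d : ℕ) (ε : ℝ) : Set (BlockVec m d) :=
  Set.univ.pi fun q => Set.Icc (-(1 + (m - 1 - (q.1 : ℕ)) * ε)) (1 + (m - 1 - (q.1 : ℕ)) * ε)

theorem abs_le_of_mem_registerSet {y : BlockVec m d} (hy : y ∈ registerSet m d ε)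
    (q : Fin m × Fin d) : |y q| ≤ 1 + (m - 1 - (q.1 : ℕ)) * ε :=
  abs_le.2 (hy q (Set.mem_univ q))

theorem abs_le_two_of_mem_registerSet (hε : 0 ≤ ε) (hmε : m * ε ≤ 1) {y : BlockVec m d}
    (hy : y ∈ registerSet m d ε) (q : Fin m × Fin d) : |y q| ≤ 2 := by
  have h := abs_le_of_mem_registerSet hy q
  have h₁ : (0 : ℝ) ≤ (q.1 : ℕ) := Nat.cast_nonneg _
  have h₂ := mul_nonneg h₁ hε
  nlinarith

/-- Each shift moves a block one place away from the last, where the allowed bound is larger by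
exactly the `ε` that `G` may add. The hypothesis `hmε` keeps all bounds below `2`, where `G` is
controlled. -/
theorem shiftStep_mem_registerSet (hε : 0 ≤ ε) (hmε : m * ε ≤ 1)
    (hGε : ∀ y, (∀ q, |y q| ≤ 2) → ∀ q, |G y q - y q| ≤ ε) {v : Fin d → ℝ}
    (hv : ∀ i, |v i| ≤ 1) {y : BlockVec m d} (hy : y ∈ registerSet m d ε) :
    shiftStep G v y ∈ registerSet m d ε := by
  intro q _
  rw [Set.mem_Icc, ← abs_le, shiftStep]
  split_ifs with h
  · have h₁ := abs_le_of_mem_registerSet hy (⟨q.1 + 1, h⟩, q.2)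
    have h₂ := hGε y (abs_le_two_of_mem_registerSet hε hmε hy) (⟨q.1 + 1, h⟩, q.2)
    have h₃ := abs_sub_abs_le_abs_sub (G y (⟨q.1 + 1, h⟩, q.2)) (y (⟨q.1 + 1, h⟩, q.2))
    push_cast at h₁
    linarith
  · have h₁ : ((q.1 : ℕ) : ℝ) + 1 ≤ m := by exact_mod_cast q.1.2
    have h₂ : 0 ≤ ((m : ℝ) - 1 - (q.1 : ℕ)) * ε := mul_nonneg (by linarith) hε
    exact (hv _).trans (by linarith)

/-- Left infinite orbits of a perturbed shift register exist, by compactness. -/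
theorem exists_shiftStep_orbit (hG : Continuous G) (hε : 0 ≤ ε) (hmε : m * ε ≤ 1)
    (hGε : ∀ y, (∀ q, |y q| ≤ 2) → ∀ q, |G y q - y q| ≤ ε) {v : ℕ → Fin d → ℝ}
    (hv : ∀ k i, |v k i| ≤ 1) :
    ∃ y : ℕ → BlockVec m d, (∀ k, y k = shiftStep G (v k) (y (k + 1))) ∧
      ∀ k q, |y k q| ≤ 2 := by
  -- Sequences in the compact product that satisfy the recursion at the `N` most recent times:
  -- nested closed sets, whose common points are full orbits.
  let T : ℕ → Set (ℕ → BlockVec m d) := fun N =>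
    (Set.univ.pi fun _ => registerSet m d ε) ∩
      ⋂ k, ⋂ (_ : k < N), {y | y k = shiftStep G (v k) (y (k + 1))}
  have hcl : ∀ N, IsClosed (T N) := fun N =>
    (isClosed_set_pi fun _ _ => isClosed_set_pi fun _ _ => isClosed_Icc).inter
      (isClosed_iInter fun k => isClosed_iInter fun _ =>
        isClosed_eq (continuous_apply k) ((continuous_shiftStep hG _).comp (continuous_apply _)))
  have hcomp : IsCompact (T 0) :=
    (isCompact_univ_pi fun _ => isCompact_univ_pi fun _ => isCompact_Icc).of_isClosed_subset
      (hcl 0) Set.inter_subset_left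
  have hanti : ∀ N, T (N + 1) ⊆ T N := fun N y hy => ⟨hy.1, by
    have h := hy.2
    simp only [Set.mem_iInter] at h ⊢
    exact fun k hk => h k (by omega)⟩
  -- Start from the zero register `N` steps ago and iterate forward. The input is quantified inside
  -- because the induction step delays it by one and adds a new state at time `0`.
  have hne : ∀ N, ∀ v : ℕ → Fin d → ℝ, (∀ k i, |v k i| ≤ 1) → ∃ y : ℕ → BlockVec m d,
      (∀ k, y k ∈ registerSet m d ε) ∧ ∀ k < N, y k = shiftStep G (v k) (y (k + 1)) := by
    intro N
    induction N with
    | zero =>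
      refine fun v _ => ⟨fun _ _ => 0, fun k q _ => ?_, fun k hk => absurd hk (by omega)⟩
      have h₁ : ((q.1 : ℕ) : ℝ) + 1 ≤ m := by exact_mod_cast q.1.2
      have h₂ : 0 ≤ ((m : ℝ) - 1 - (q.1 : ℕ)) * ε := mul_nonneg (by linarith) hε
      exact ⟨by linarith, by linarith⟩
    | succ N ih =>
      intro v hv
      obtain ⟨y, hy, hs⟩ := ih (fun k => v (k + 1)) fun k => hv (k + 1)
      refine ⟨fun k => Nat.casesOn k (shiftStep G (v 0) (y 0)) y, fun k => ?_, fun k hk => ?_⟩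
      · cases k with
        | zero => exact shiftStep_mem_registerSet hε hmε hGε (hv 0) (hy 0)
        | succ k => exact hy k
      · cases k with
        | zero => rfl
        | succ k => exact hs k (by omega)
  obtain ⟨y, hy⟩ := IsCompact.nonempty_iInter_of_sequence_nonempty_isCompact_isClosed T hanti
    (fun N => by
      obtain ⟨y, hy, hs⟩ := hne N v hv
      exact ⟨y, fun k _ => hy k, Set.mem_iInter₂.2 hs⟩) hcomp hcl
  rw [Set.mem_iInter] at hy
  refine ⟨y, fun k => ?_, fun k =>
    abs_le_two_of_mem_registerSet hε hmε ((hy 0).1 k (Set.mem_univ k))⟩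
  have h := (hy (k + 1)).2
  simp only [Set.mem_iInter] at h
  exact h k (by omega)

/-- An input enters exactly in the last block; reaching the block at distance `r` takes `r` passes
through `G`, each costing at most `ε`. -/
theorem abs_orbit_sub_le (hGε : ∀ y, (∀ q, |y q| ≤ 2) → ∀ q, |G y q - y q| ≤ ε)
    {v : ℕ → Fin d → ℝ} {y : ℕ → BlockVec m d}
    (hy : ∀ k, y k = shiftStep G (v k) (y (k + 1))) (hy2 : ∀ k q, |y k q| ≤ 2) (r : ℕ) :
    ∀ (k : ℕ) (q : Fin m × Fin d), (q.1 : ℕ) + r + 1 = m →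
      |y k q - v (k + r) q.2| ≤ r * ε := by
  induction r with
  | zero =>
    intro k q hq
    rw [hy k, shiftStep, dif_neg (by omega)]
    simp
  | succ r ih =>
    intro k q hq
    have h : (q.1 : ℕ) + 1 < m := by omega
    have h₁ := ih (k + 1) (⟨q.1 + 1, h⟩, q.2) (by simp only; omega)
    have h₂ := hGε (y (k + 1)) (hy2 (k + 1)) (⟨q.1 + 1, h⟩, q.2)
    rw [hy k, shiftStep, dif_pos h, show k + (r + 1) = k + 1 + r by ring]
    refine (abs_sub_le _ (y (k + 1) (⟨q.1 + 1, h⟩, q.2)) _).trans ?_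
    push_cast
    linarith

end ShiftRegister

/-- The map `x ↦ (24/n) Wᵀ relu(W x + b)`, an approximation of the identity. -/
noncomputable def decodeEncode {n m d : ℕ} (X : Fin n → BlockVec m d × ℝ) (y : BlockVec m d) :
    BlockVec m d :=
  fun q => 24 / n * ∑ i, (X i).1 q * relu (affine y (X i))

theorem continuous_decodeEncode {n m d : ℕ} (X : Fin n → BlockVec m d × ℝ) :
    Continuous (decodeEncode X) := by
  refine continuous_pi fun q => continuous_const.mul (continuous_finsetSum _ fun i _ => ?_)
  exact continuous_const.mul (continuous_relu.comp (continuous_affine_left _))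

/-- The factor `24` is split as `12 * 2` because `2 w_q` is the weight normalized to be bounded by
`1` on the cube. -/
theorem decodeEncode_sub {n m d : ℕ} (X : Fin n → BlockVec m d × ℝ) (y : BlockVec m d)
    (q : Fin m × Fin d) :
    decodeEncode X y q - y q =
      12 * (empiricalMean X (fun p => 2 * p.1 q) y - featureMean (fun p => 2 * p.1 q) y) := by
  simp only [decodeEncode, empiricalMean, featureMean, mul_assoc, integral_const_mul,
    integral_fst_mul_relu, ← Finset.mul_sum]
  ring

/-- Recurrent and input matrices share the left factor `W`, so the network update of an encoded
register is the encoding of the shifted register. -/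
theorem recurrentMatrix_mulVec_add {n m d : ℕ} (X : Fin n → BlockVec m d × ℝ) (v : Fin d → ℝ)
    (y : BlockVec m d) (i : Fin n) :
    ((recurrentMatrix X).mulVec (fun i => relu (affine y (X i))) + (inputMatrix X).mulVec v +
      biasVector X) i = affine (shiftStep (decodeEncode X) v y) (X i) := by
  have e : (24 / (n : ℝ)) •
      (weightMatrix X).transpose.mulVec (fun i => relu (affine y (X i))) = decodeEncode X y := by
    ext q
    simp [decodeEncode, Matrix.mulVec, dotProduct, weightMatrix]
  rw [recurrentMatrix, inputMatrix, ← Matrix.mulVec_mulVec, ← Matrix.mulVec_mulVec,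
    ← Matrix.mulVec_add, Matrix.smul_mulVec, ← Matrix.mulVec_mulVec, ← Matrix.mulVec_smul, e]
  have h : (matP m d).mulVec (decodeEncode X y) + (matQ m d).mulVec v =
      shiftStep (decodeEncode X) v y := by
    ext q
    exact matP_mulVec_add_matQ_mulVec _ _ q
  rw [h]
  rfl

/-- The values of a block of inputs, as a vector. -/
def blockValue {m d : ℕ} (x : Fin m → Fin d → Box) : BlockVec m d := fun q => x q.1 q.2

theorem abs_coe_box_le (x : Box) : |(x : ℝ)| ≤ 1 := abs_le.2 x.2

/-- If `(24/n) Wᵀ relu(W x + b)` is close to `x`, then the network has solutions whose current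
state encodes the last `m` inputs. -/
theorem exists_solution_encoding {n m d : ℕ} {X : Fin n → BlockVec m d × ℝ} {ε : ℝ} (hε : 0 ≤ ε)
    (hmε : m * ε ≤ 1)
    (hGε : ∀ y, (∀ q, |y q| ≤ 2) → ∀ q, |decodeEncode X y q - y q| ≤ ε) (u : PastInput d) :
    ∃ (s : ℕ → Fin n → ℝ) (y : BlockVec m d),
      IsSolution relu (recurrentMatrix X) (inputMatrix X) (biasVector X) u s ∧
      (∀ i, s 0 i = relu (affine y (X i))) ∧
      ∀ q, |blockValue (lastBlock m u) q - y q| ≤ m * ε := by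
  obtain ⟨y, hy, hy2⟩ := exists_shiftStep_orbit (continuous_decodeEncode X) hε hmε hGε
    (v := fun k i => (u k i : ℝ)) fun k i => abs_coe_box_le _
  refine ⟨fun k i => relu (affine (y k) (X i)), y 0, fun k i => ?_, fun i => rfl, fun q => ?_⟩
  · rw [recurrentMatrix_mulVec_add, ← hy k]
  · have hq := q.1.2
    have h := abs_orbit_sub_le hGε hy hy2 (m - 1 - q.1) 0 q (by omega)
    rw [abs_sub_comm]
    simp only [zero_add] at h
    refine h.trans (mul_le_mul_of_nonneg_right ?_ hε)
    exact_mod_cast (by omega : m - 1 - (q.1 : ℕ) ≤ m)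

end ESN

/-! ### Operators from functionals, and the normalized density -/

namespace ESN

/-- The input up to time `t`, as a left infinite sequence. -/
def pastAt {d : ℕ} (u : Input d) (t : ℤ) : PastInput d := fun k => u (t - k)

theorem eq_functional_pastAt {d : ℕ} {F : Input d → ℤ → ℝ} (hcausal : IsCausal F)
    (hinv : IsTimeInvariant F) (u : Input d) (t : ℤ) : F u t = functional F (pastAt u t) := by
  have h := hinv u (-t) 0
  rw [zero_sub, neg_neg] at h
  rw [← h]
  refine (functional_eq hcausal _ _ fun k => ?_).symm
  simp only [pastAt]
  congr 1
  ring

/-- Solutions whose outputs are close to `F*` can be assembled to an associated operator that is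
close to `F`. -/
theorem exists_associatedOperator {n d : ℕ} {φ : ℝ → ℝ} {W₁ : Matrix (Fin n) (Fin n) ℝ}
    {W₂ : Matrix (Fin n) (Fin d) ℝ} {b a : Fin n → ℝ} {F : Input d → ℤ → ℝ}
    (hcausal : IsCausal F) (hinv : IsTimeInvariant F) {C : ℝ}
    (hs : ∀ u, ∃ s, IsSolution φ W₁ W₂ b u s ∧ |functional F u - a ⬝ᵥ s 0| ≤ C) :
    ∃ H, IsAssociatedOperator φ W₁ W₂ b a H ∧ ∀ u t, |F u t - H u t| ≤ C := by
  choose S hS hC using hs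
  -- Solutions may be chosen independently for each past: the output at `t` uses only the past at
  -- `t`, which makes the operator causal and time-invariant.
  refine ⟨fun u t => a ⬝ᵥ S (pastAt u t) 0, ⟨fun u v t huv => ?_, fun u τ t => ?_, S, hS,
    fun u => ?_⟩, fun u t => ?_⟩
  · have : pastAt u t = pastAt v t := funext fun k => huv _ (by omega)
    simp only [this]
  · have : pastAt (fun k => u (k - τ)) t = pastAt u (t - τ) := by
      ext k : 1
      simp only [pastAt]
      congr 1
      ring
    simp only [this]
  · have : pastAt (extendPast u) 0 = u := by
      ext k : 1
      simp [pastAt, extendPast]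
    simp only [functional, this]
  · rw [eq_functional_pastAt hcausal hinv]
    exact hC _

theorem abs_functional_sub_le_memoryError {d : ℕ} {F : Input d → ℤ → ℝ}
    (hF : IsContinuousOperator F) (m : ℕ) (u : PastInput d) :
    |functional F u - finiteFunctional F m (lastBlock m u)| ≤ memoryError F m := by
  obtain ⟨⟨K, -, hK⟩, -⟩ := hF
  refine le_ciSup (f := fun u => |functional F u - finiteFunctional F m (lastBlock m u)|)
    ⟨K + K, ?_⟩ u
  rintro _ ⟨v, rfl⟩
  exact (abs_sub _ _).trans (add_le_add (hK _ _) (hK _ _))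

/-- The representing function of `F*_m`, normalized to be bounded by `1`. -/
theorem HasIntegralRepresentation.exists_normalized {m d : ℕ} {F : Input d → ℤ → ℝ} {B : ℝ}
    (hrep : HasIntegralRepresentation F m B) :
    0 ≤ B ∧ ∃ h : BlockVec m d × ℝ → ℝ, Measurable h ∧ (∀ p ∈ paramCube m d, |h p| ≤ 1) ∧
      ∀ x, finiteFunctional F m x = B * featureMean h (blockValue x) := by
  obtain ⟨g, hm, hb, hg⟩ := hrep
  have hb' : ∀ p ∈ paramCube m d, |g p.1 p.2| ≤ B := fun p hp => hb _ hp.1 _ hp.2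
  have hB : 0 ≤ B := (abs_nonneg _).trans
    (hb' 0 ⟨fun _ _ => ⟨by norm_num, by norm_num⟩, ⟨by norm_num, by norm_num⟩⟩)
  refine ⟨hB, fun p => g p.1 p.2 / B, hm.div_const B, fun p hp => ?_, fun x => ?_⟩
  · rw [abs_div, abs_of_nonneg hB]
    exact div_le_one_of_le₀ (hb' p hp) hB
  · rw [hg, featureMean, ← integral_const_mul]
    refine (setIntegral_setIntegral_eq (integrable_mul_relu hm hb' (blockValue x))).trans ?_
    refine integral_congr_ae ((ae_mem_paramCube m d).mono fun p hp => ?_)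
    -- If `B = 0`, the quotient `g / B` is `0` by convention, which is harmless since `g` vanishes
    -- on the cube.
    rcases hB.eq_or_lt with h0 | h0
    · have : g p.1 p.2 = 0 := abs_nonpos_iff.1 (h0 ▸ hb' p hp)
      simp [this]
    · simp only
      field_simp

end ESN

/-! ### The probability budget and the final error estimate -/

open ESN in
theorem mainTheorem3 (n m d : ℕ) (hn : 1 ≤ n) (hm : 1 ≤ m) (hd : 1 ≤ d)
    (δ : ℝ) (hδ0 : 0 < δ) (hδ1 : δ < 1)
    (hlarge : ESN.thresholdC m d δ ≤ (n : ℝ) / Real.log ((n : ℝ) + 1))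
    {Ω : Type*} [MeasurableSpace Ω] (μ : Measure Ω) [IsProbabilityMeasure μ]
    (X : Fin n → Ω → ESN.BlockVec m d × ℝ)
    (hmeas : ∀ i, Measurable (X i))
    (hindep : iIndepFun X μ)
    (hunif : ∀ i, pdf.IsUniform (X i)
      (ESN.cube m d ×ˢ Set.Icc (-(1 / 2) : ℝ) (1 / 2)) μ volume)
    (F : ESN.Input d → ℤ → ℝ)
    (hcausal : ESN.IsCausal F) (hinv : ESN.IsTimeInvariant F)
    (hcont : ESN.IsContinuousOperator F)
    (B : ℝ) (hrep : ESN.HasIntegralRepresentation F m B) :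
    ∃ E : Set Ω, MeasurableSet E ∧ 1 - δ ≤ μ.real E ∧ ∀ ω ∈ E,
      ESN.HasSolutions ESN.relu (ESN.recurrentMatrix fun i => X i ω)
        (ESN.inputMatrix fun i => X i ω) (ESN.biasVector fun i => X i ω) ∧
      ∃ (a : Fin n → ℝ) (H : ESN.Input d → ℤ → ℝ),
        ESN.IsAssociatedOperator ESN.relu (ESN.recurrentMatrix fun i => X i ω)
          (ESN.inputMatrix fun i => X i ω) (ESN.biasVector fun i => X i ω) a H ∧
        ∀ (u : ESN.Input d) (t : ℤ),
          |F u t - H u t| ≤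
            ESN.constC m d δ B * √(Real.log ((n : ℝ) + 1) / n) + ESN.memoryError F m := by
  have hlaw : ∀ i, μ.map (X i) = paramLaw m d := fun i => map_eq_paramLaw (hunif i)
  have hlog := eight_le_log hn hm hlarge
  obtain ⟨hB, h, hhm, hhb, hF⟩ := hrep.exists_normalized
  set t := deviationRate n m d δ with ht
  have ht0 : 0 ≤ t := deviationRate_nonneg n m d δ
  have hmesh : (m : ℝ) * d / n ≤ t / 4 := mesh_le_deviationRate hn hlog
  have hevent : ∀ f : BlockVec m d × ℝ → ℝ, Measurable f → (∀ p ∈ paramCube m d, |f p| ≤ 1) →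
      ∃ E : Set Ω, MeasurableSet E ∧ μ.real Eᶜ ≤ δ / (2 * (m * d)) ∧
        ∀ ω ∈ E, (∀ i, X i ω ∈ paramCube m d) → ∀ x : BlockVec m d, (∀ q, |x q| ≤ 2) →
          |empiricalMean (fun i => X i ω) f x - featureMean f x| ≤ t := fun f hf hfb => by
    obtain ⟨E, hE, hEc, hdev⟩ := exists_uniform_deviation_event hn hmeas hindep hlaw hf hfb
      (s := 3 / 4 * t) (by positivity)
    exact ⟨E, hE, hEc.trans (grid_tail_le hn hm hd hδ0 hδ1 hlog), fun ω hω hc x hx =>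
      (hdev ω hω hc x hx).trans (by linarith)⟩
  obtain ⟨E₀, hE₀, hE₀c, hdev₀⟩ := hevent h hhm hhb
  choose E₁ hE₁ hE₁c hdev₁ using fun q : Fin m × Fin d =>
    hevent (fun p => 2 * p.1 q) (by fun_prop) fun p hp => by
      rw [abs_mul, abs_two]
      linarith [abs_fst_le hp q]
  have hcube : MeasurableSet {ω | ∀ i, X i ω ∈ paramCube m d} := by
    rw [Set.ofPred_forall]
    exact MeasurableSet.iInter fun i => hmeas i (measurableSet_paramCube m d)
  have hcube' : μ.real {ω | ∀ i, X i ω ∈ paramCube m d}ᶜ = 0 := by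
    have hae : ∀ᵐ ω ∂μ, ∀ i, X i ω ∈ paramCube m d := ae_all_iff.2 fun i =>
      ae_of_ae_map (hmeas i).aemeasurable (by rw [hlaw i]; exact ae_mem_paramCube m d)
    rw [measureReal_def, mem_ae_iff.1 hae, ENNReal.toReal_zero]
  have hEm : MeasurableSet ((E₀ ∩ ⋂ q, E₁ q) ∩ {ω | ∀ i, X i ω ∈ paramCube m d}) :=
    (hE₀.inter (MeasurableSet.iInter hE₁)).inter hcube
  refine ⟨_, hEm, ?_, ?_⟩
  -- The `md` weight events cost `δ/2` together, the event for `h` at most another `δ/2`, and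
  -- leaving the cube is null.
  · have hc : μ.real ((E₀ ∩ ⋂ q, E₁ q) ∩ {ω | ∀ i, X i ω ∈ paramCube m d})ᶜ ≤ δ := by
      have hD := one_le_mul_cast hm hd
      have h₁ : μ.real (⋃ q, (E₁ q)ᶜ) ≤ m * d * (δ / (2 * (m * d))) := by
        refine (measureReal_iUnion_fintype_le _).trans
          ((Finset.sum_le_sum fun q _ => hE₁c q).trans (le_of_eq ?_))
        simp
      have h₂ : (m : ℝ) * d * (δ / (2 * (m * d))) = δ / 2 := by
        have : (m : ℝ) * d ≠ 0 := by linarith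
        field_simp
      have h₃ : δ / (2 * ((m : ℝ) * d)) ≤ δ / 2 :=
        div_le_div_of_nonneg_left hδ0.le two_pos (by linarith)
      rw [Set.compl_inter, Set.compl_inter, Set.compl_iInter]
      have h₄ := measureReal_union_le (μ := μ) (E₀ᶜ ∪ ⋃ q, (E₁ q)ᶜ)
        {ω | ∀ i, X i ω ∈ paramCube m d}ᶜ
      have h₅ := measureReal_union_le (μ := μ) E₀ᶜ (⋃ q, (E₁ q)ᶜ)
      linarith
    rw [probReal_compl_eq_one_sub hEm] at hc
    linarith
  · rintro ω ⟨⟨hω₀, hω₁⟩, hωc⟩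
    have hG : ∀ y, (∀ q, |y q| ≤ 2) →
        ∀ q, |decodeEncode (fun i => X i ω) y q - y q| ≤ 12 * t := fun y hy q => by
      rw [decodeEncode_sub, abs_mul, abs_of_pos (by norm_num : (0 : ℝ) < 12)]
      exact mul_le_mul_of_nonneg_left
        (hdev₁ q ω (Set.mem_iInter.1 hω₁ q) hωc y hy) (by norm_num)
    have hsol := exists_solution_encoding (X := fun i => X i ω) (by positivity)
      (mul_deviationRate_le_one hn hlarge) hG
    refine ⟨fun u => ?_, fun i => B * h (X i ω) / n,
      exists_associatedOperator hcausal hinv fun u => ?_⟩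
    · obtain ⟨s, -, hs, -⟩ := hsol u
      exact ⟨s, hs⟩
    · obtain ⟨s, y, hs, hs0, hy⟩ := hsol u
      refine ⟨s, hs, ?_⟩
      have ha : (fun i => B * h (X i ω) / n) ⬝ᵥ s 0 =
          B * empiricalMean (fun i => X i ω) h y := by
        rw [empiricalMean, dotProduct, Finset.sum_div, Finset.mul_sum]
        refine Finset.sum_congr rfl fun i _ => ?_
        rw [hs0]
        ring
      have h₁ := hdev₀ ω hω₀ hωc (blockValue (lastBlock m u)) fun q =>
        (abs_coe_box_le _).trans (by norm_num)
      have h₂ := abs_empiricalMean_sub_le (X := fun i => X i ω) hn hωc hhb hy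
      have h₃ := abs_functional_sub_le_memoryError hcont m u
      have h₄ := mul_deviationRate_le_constC (n := n) (m := m) (d := d) (δ := δ) hB
      rw [ha]
      refine (abs_sub_le _ (finiteFunctional F m (lastBlock m u)) _).trans ?_
      -- The Monte Carlo error `t` is taken at the true inputs; the Lipschitz bound then passes to
      -- the register `y`, at distance at most `12 m t`.
      have h₅ : |finiteFunctional F m (lastBlock m u) -
          B * empiricalMean (fun i => X i ω) h y| ≤
          B * (t + 1 * (m * d / 2 * (m * (12 * t)))) := by
        rw [hF, ← mul_sub, abs_mul, abs_of_nonneg hB]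
        refine mul_le_mul_of_nonneg_left ?_ hB
        refine (abs_sub_le _ (empiricalMean (fun i => X i ω) h
          (blockValue (lastBlock m u))) _).trans (add_le_add ?_ h₂)
        rwa [abs_sub_comm]
      rw [← ht] at h₄
      linarith
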